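/- For $n\ge 0$ let $C_n=\{\pm1\}^n\rtimes\mathfrak S_n$ be the group of signed permutations of $n$ coordinates (for $n\ge 1$, the symmetry group of the $n$-dimensional hypercube), where $\mathfrak S_n$ acts on $\{\pm1\}^n$ by permuting coordinates. Then $|C_n|=2^n\,n!$. Let $\mathcal H(C_n)=|\mathrm{End}(C_n)|$ be the number of group homomorphisms $C_n\to C_n$, and let $X_n=|\varphi(C_n)|$ be the order of the image of an endomorphism $\varphi$ drawn uniformly at random from $\mathrm{End}(C_n)$. As $n\to\infty$, a random endomorphism of $C_n$ asymptotically almost surely has large image, and hence small kernel: (a) $\displaystyle\lim_{n\to\infty}\mathbb P\big[\,n!\le X_n\le 2^n\,n!\,\big]=1$; (b) $\mathcal H(C_n)\sim 2^{n+2}\,n!$, i.e. $\displaystyle\lim_{n\to\infty}\frac{\mathcal H(C_n)}{2^{n+2}\,n!}=1$. -/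

import Mathlib

open Filter Topology Asymptotics
open scoped Nat

/-- The group `C_n = N ⋊ S_n` of signed permutations (the symmetry group of the `n`-cube):
`N = {±1}^n` is the group of coordinate inversions, and `S_n` permutes the coordinates, acting
on `N` by `(σ • ε) i = ε (σ⁻¹ i)`. The pair `(ε, σ)` acts on `ℝ^n` by
`e_i ↦ ε (σ i) e_{σ i}`. -/
abbrev SignedPerm (n : ℕ) : Type :=
  (Fin n → ℤˣ) ⋊[mulAutArrow] Equiv.Perm (Fin n)

instance SignedPerm.instFinite (n : ℕ) : Finite (SignedPerm n) :=
  Finite.of_equiv _ SemidirectProduct.equivProd.symm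

instance SignedPerm.instFiniteEnd (n : ℕ) : Finite (Monoid.End (SignedPerm n)) :=
  Finite.of_injective (fun f : Monoid.End (SignedPerm n) => (f : SignedPerm n → SignedPerm n))
    DFunLike.coe_injective

noncomputable instance SignedPerm.instFintypeEnd (n : ℕ) : Fintype (Monoid.End (SignedPerm n)) :=
  Fintype.ofFinite _

/-- The number of endomorphisms of `C_n`. -/
noncomputable def numEnd (n : ℕ) : ℕ := Nat.card (Monoid.End (SignedPerm n))

/-- The order of the image of an endomorphism of `C_n`. -/
noncomputable def imageOrder (n : ℕ) (f : Monoid.End (SignedPerm n)) : ℕ :=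
  Nat.card (MonoidHom.range f)

/-- The law of `X_n`, the order of the image of an endomorphism drawn uniformly at random from
`End(C_n)`. -/
noncomputable def imageOrderLaw (n : ℕ) : PMF ℕ :=
  (PMF.uniformOfFintype (Monoid.End (SignedPerm n))).map (imageOrder n)

/-! Write `C_n = N ⋊ S_n` with `N = {±1}^n`, and split endomorphisms by whether the induced map
`permPart f : S_n → C_n → S_n` is injective.

If it is injective and `n ≥ 7`, it is conjugation by some `τ`, and `f` maps `N` into `N`. What
remains is a 1-cocycle of `S_n` in `N` and an equivariant endomorphism of `N`. By a Shapiro-type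
argument the cocycle is a coboundary times a power of `sign`; the endomorphism is `ε ↦ ε ^ b * (∏ ε)
^ d`. So `f` is a `conjTwist`, unique once the conjugator is normalised modulo the central `-1`:
there are `2^(n-1) * n! * 2^3 = 2^(n+2) * n!` of them, each with image of order at least `n!`.

If it is not injective and `n ≥ 5`, then `f` kills the alternating group and is determined by two
commuting involutions of `C_n`. Such pairs number at most `2^(9n) * n^(3n/4)`, which is `o(n!)`. The
injective class therefore dominates, giving both limits. -/

/-! ### Injective endomorphisms of the symmetric group are inner -/

namespace Equiv.Perm

theorem swap_mul_swap_pow_six {α : Type*} [DecidableEq α] (a b c d : α) :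
    (swap a b * swap c d) ^ 6 = 1 := by
  have hthree : ∀ x y z : α, (swap x y * swap x z) ^ 6 = 1 := by
    intro x y z
    by_cases hxy : x = y
    · subst hxy
      rw [swap_self, show (Equiv.refl α : Perm α) = 1 from rfl, one_mul,
        show 6 = 2 * 3 from rfl, pow_mul, sq, swap_mul_self, one_pow]
    by_cases hxz : x = z
    · subst hxz
      rw [swap_self, show (Equiv.refl α : Perm α) = 1 from rfl, mul_one,
        show 6 = 2 * 3 from rfl, pow_mul, sq, swap_mul_self, one_pow]
    have h3 : (swap x y * swap x z) ^ 3 = 1 := by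
      ext w
      simp only [pow_succ, pow_zero, one_mul, coe_mul, Function.comp_apply, one_apply]
      grind (splits := 20)
    rw [show 6 = 3 * 2 from rfl, pow_mul, h3, one_pow]
  by_cases h1 : a = c
  · subst h1; exact hthree _ _ _
  by_cases h2 : a = d
  · subst h2; rw [swap_comm c]; exact hthree _ _ _
  by_cases h3 : b = c
  · subst h3; rw [swap_comm a]; exact hthree _ _ _
  by_cases h4 : b = d
  · subst h4; rw [swap_comm a, swap_comm c]; exact hthree _ _ _
  have hcomm : Commute (swap a b) (swap c d) := by
    ext w
    simp only [coe_mul, Function.comp_apply]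
    grind
  rw [hcomm.mul_pow, show 6 = 2 * 3 from rfl, pow_mul, pow_mul, sq, sq, swap_mul_self,
    swap_mul_self, one_pow, one_mul]

/-- Conjugating by the 5-cycle `a → b → c → d → e` gives an `s` with 2-cycles `(b c)`, `(d e)` that
fixes `a`. Then `t * s` has the 5-cycle `a → b → d → e → c`, and 5 does not divide 6. -/
theorem not_forall_conj_pow_six_of_fixed {α : Type*} [DecidableEq α] {t : Perm α}
    {a b c d e : α} (hab : t a = b) (hba : t b = a) (hcd : t c = d) (hdc : t d = c) (he : t e = e)
    (hne : [a, b, c, d, e].Nodup) : ¬ ∀ g : Perm α, (t * (g * t * g⁻¹)) ^ 6 = 1 := by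
  intro h
  let g : Perm α := swap a b * swap b c * swap c d * swap d e
  simp only [List.nodup_cons, List.mem_cons, List.not_mem_nil, or_false, not_or,
    List.nodup_nil, not_false_eq_true, and_true] at hne
  have conj : ∀ x, (g * t * g⁻¹) (g x) = g (t x) := fun x => by simp
  have ga : g a = b := by simp [g]; grind
  have gb : g b = c := by simp [g]; grind
  have gc : g c = d := by simp [g]; grind
  have gd : g d = e := by simp [g]; grind
  have ge : g e = a := by simp [g]
  have ca := conj a; have cb := conj b; have cc := conj c; have cd := conj d; have ce := conj e
  rw [hab, ga, gb] at ca
  rw [hba, ga, gb] at cb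
  rw [hcd, gc, gd] at cc
  rw [hdc, gc, gd] at cd
  rw [he, ge] at ce
  have := congrArg (fun p : Perm α => p a) (h g)
  generalize g * t * g⁻¹ = s at *
  simp only [pow_succ, pow_zero, one_mul, coe_mul, Function.comp_apply, one_apply, *] at this
  tauto

/-- Conjugating by the 8-cycle through the listed points shifts the 2-cycles by one place, so `t *
s` has the 4-cycle `a → x → e → c`, whose sixth power is not the identity. -/
theorem not_forall_conj_pow_six_of_four {α : Type*} [DecidableEq α] {t : Perm α}
    {a b c d e f x y : α} (hba : t b = a) (hdc : t d = c)
    (hfe : t f = e) (hyx : t y = x)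
    (hne : [a, b, c, d, e, f, x, y].Nodup) : ¬ ∀ g : Perm α, (t * (g * t * g⁻¹)) ^ 6 = 1 := by
  intro h
  let g : Perm α := swap a b * swap b c * swap c d * swap d e * swap e f * swap f x * swap x y
  simp only [List.nodup_cons, List.mem_cons, List.not_mem_nil, or_false, not_or,
    List.nodup_nil, not_false_eq_true, and_true] at hne
  have conj : ∀ x, (g * t * g⁻¹) (g x) = g (t x) := fun x => by simp
  have ga : g a = b := by simp [g]; grind
  have gb : g b = c := by simp [g]; grind
  have gc : g c = d := by simp [g]; grind
  have gd : g d = e := by simp [g]; grind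
  have ge : g e = f := by simp [g]; grind
  have gf : g f = x := by simp [g]; grind
  have gx : g x = y := by simp [g]; grind
  have gy : g y = a := by simp [g]
  have cb := conj b; have cd := conj d; have cf := conj f; have cy := conj y
  rw [hba, ga, gb] at cb
  rw [hdc, gc, gd] at cd
  rw [hfe, ge, gf] at cf
  rw [hyx, gx, gy] at cy
  have := congrArg (fun p : Perm α => p a) (h g)
  generalize g * t * g⁻¹ = s at *
  simp only [pow_succ, pow_zero, one_mul, coe_mul, Function.comp_apply, one_apply, *] at this
  tauto

/-- This characterises transpositions by a group-theoretic property. It fails for `n = 6`, where the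
outer automorphism exchanges transpositions and triple transpositions. -/
theorem isSwap_of_forall_conj_pow_six {n : ℕ} (hn : 7 ≤ n) {t : Perm (Fin n)} (h1 : t ≠ 1)
    (h2 : t * t = 1) (h : ∀ g, (t * (g * t * g⁻¹)) ^ 6 = 1) : t.IsSwap := by
  have hinv : ∀ x, t (t x) = x := fun x => by rw [← mul_apply, h2, one_apply]
  have hex : ∀ s : Finset (Fin n), s.card < 7 → ∃ x, x ∉ s := by
    intro s hs
    by_contra! hcon
    have : s = Finset.univ := Finset.eq_univ_iff_forall.2 hcon
    subst this
    simp at hs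
    omega
  obtain ⟨a, ha⟩ : ∃ a, t a ≠ a := by
    by_contra! hcon
    exact h1 (Perm.ext hcon)
  have haa := hinv a
  by_contra hsw
  obtain ⟨c, hca, hcb, hc⟩ : ∃ c, c ≠ a ∧ c ≠ t a ∧ t c ≠ c := by
    by_contra! hcon
    refine hsw ⟨a, t a, ha.symm, Perm.ext fun x => ?_⟩
    by_cases hxa : x = a
    · simp [hxa]
    by_cases hxb : x = t a
    · simp [hxb, haa]
    rw [hcon x hxa hxb, swap_apply_of_ne_of_ne hxa hxb]
  have hcc := hinv c
  have i1 : t a ≠ c := hcb.symm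
  have i2 : t c ≠ a := fun h => by rw [h] at hcc; exact hcb hcc.symm
  have i3 : t a ≠ t c := fun h => hca (t.injective h).symm
  by_cases hfix : ∃ e, t e = e
  · obtain ⟨e, he⟩ := hfix
    refine not_forall_conj_pow_six_of_fixed rfl haa rfl hcc he ?_ h
    simp only [List.nodup_cons, List.mem_cons, List.not_mem_nil, or_false, not_or,
      List.nodup_nil, not_false_eq_true, and_true]
    grind
  push Not at hfix
  -- Without fixed points, seven points force at least four 2-cycles.
  obtain ⟨e, he⟩ := hex {a, t a, c, t c} (lt_of_le_of_lt Finset.card_le_four (by norm_num))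
  obtain ⟨x, hx⟩ := hex {a, t a, c, t c, e, t e}
    (lt_of_le_of_lt Finset.card_le_six (by norm_num))
  simp only [Finset.mem_insert, Finset.mem_singleton, not_or] at he hx
  have hee := hinv e
  have hxx := hinv x
  have := hfix e
  have := hfix x
  refine not_forall_conj_pow_six_of_four haa hcc hee hxx ?_ h
  simp only [List.nodup_cons, List.mem_cons, List.not_mem_nil, or_false, not_or,
      List.nodup_nil, not_false_eq_true, and_true]
  grind

theorem IsSwap.map_of_injective {n : ℕ} (hn : 7 ≤ n) {α : Perm (Fin n) →* Perm (Fin n)}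
    (hα : Function.Injective α) {t : Perm (Fin n)} (ht : t.IsSwap) : (α t).IsSwap := by
  obtain ⟨i, j, hij, rfl⟩ := ht
  have hsurj : Function.Surjective α := Finite.surjective_of_injective hα
  refine isSwap_of_forall_conj_pow_six hn ?_ ?_ fun g => ?_
  · rw [Ne, map_eq_one_iff α hα, swap_eq_one_iff]
    exact hij
  · rw [← map_mul, swap_mul_self, map_one]
  · obtain ⟨g, rfl⟩ := hsurj g
    rw [← map_inv, ← map_mul, ← map_mul, ← map_mul, ← map_pow, ← map_one α]
    congr 1
    rw [← swap_apply_apply, swap_mul_swap_pow_six]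

/-- Distinct transpositions commute exactly when disjoint, so `α` preserves whether they meet. The
star of transpositions through `z` goes to a star through some `p`; matching the outer ends defines
`τ`, and stars generate. -/
theorem exists_eq_conj_of_injective {n : ℕ} (hn : 7 ≤ n) {α : Perm (Fin n) →* Perm (Fin n)}
    (hα : Function.Injective α) : ∃ τ : Perm (Fin n), ∀ σ, α σ = τ * σ * τ⁻¹ := by
  have hcomm : ∀ {x y z : Fin n}, x ≠ y → x ≠ z → y ≠ z →
      ¬ Commute (α (swap x y)) (α (swap x z)) := by
    intro x y z hxy hxz hyz hc
    have h1 : swap x y * swap x z = swap x z * swap x y :=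
      hα (by rw [map_mul, map_mul]; exact hc)
    have := congrArg (fun p : Perm (Fin n) => p x) h1
    simp only [coe_mul, Function.comp_apply, swap_apply_left] at this
    grind
  have hdisj : ∀ {x y z w : Fin n}, x ≠ z → x ≠ w → y ≠ z → y ≠ w →
      Commute (swap x y) (swap z w) := by
    intro x y z w _ _ _ _
    ext u
    simp only [coe_mul, Function.comp_apply]
    grind
  have hsw : ∀ {x y : Fin n}, x ≠ y → ∃ a b, a ≠ b ∧ α (swap x y) = swap a b := fun h =>
    IsSwap.map_of_injective hn hα ⟨_, _, h, rfl⟩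
  let z : Fin n := ⟨0, by omega⟩
  let i : Fin n := ⟨1, by omega⟩
  let j : Fin n := ⟨2, by omega⟩
  have hzi : z ≠ i := by simp [z, i]
  have hzj : z ≠ j := by simp [z, j]
  have hij : i ≠ j := by simp [i, j]
  obtain ⟨p, u, v, hpu, hpv, huv, hu, hv⟩ : ∃ p u v, p ≠ u ∧ p ≠ v ∧ u ≠ v ∧
      α (swap z i) = swap p u ∧ α (swap z j) = swap p v := by
    obtain ⟨a, b, hab, h1⟩ := hsw hzi
    obtain ⟨c, d, hcd, h2⟩ := hsw hzj
    have h3 := hcomm hzi hzj hij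
    have h4 : swap a b ≠ swap c d := by
      intro h
      rw [h1, h2, h] at h3
      exact h3 (Commute.refl _)
    rw [h1, h2] at h3
    by_cases hac : a = c
    · subst hac
      exact ⟨a, b, d, hab, hcd, fun h => h4 (by rw [h]), h1, h2⟩
    by_cases had : a = d
    · subst had
      rw [swap_comm c a] at h2
      exact ⟨a, b, c, hab, hac, fun h => h4 (by rw [h, swap_comm]), h1, h2⟩
    by_cases hbc : b = c
    · subst hbc
      rw [swap_comm a b] at h1
      exact ⟨b, a, d, hab.symm, hcd, had, h1, h2⟩
    by_cases hbd : b = d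
    · subst hbd
      rw [swap_comm a b] at h1
      rw [swap_comm c b] at h2
      exact ⟨b, a, c, hab.symm, hcd.symm, hac, h1, h2⟩
    exact absurd (hdisj hac had hbc hbd) h3
  have hstar : ∀ k, k ≠ z → ∃ w, w ≠ p ∧ α (swap z k) = swap p w := by
    intro k hk
    by_cases hki : k = i
    · subst hki; exact ⟨u, hpu.symm, hu⟩
    by_cases hkj : k = j
    · subst hkj; exact ⟨v, hpv.symm, hv⟩
    obtain ⟨a, b, hab, h1⟩ := hsw (Ne.symm hk)
    have h2 := hcomm hk.symm hzi hki
    have h3 := hcomm hk.symm hzj hkj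
    rw [h1, hu] at h2
    rw [h1, hv] at h3
    by_cases hap : a = p
    · subst hap; exact ⟨b, hab.symm, h1⟩
    by_cases hbp : b = p
    · subst hbp; exact ⟨a, hab, by rw [h1, swap_comm]⟩
    exfalso
    -- A transposition missing `p` but meeting both `swap p u` and `swap p v` closes a triangle; it
    -- is then the image of `swap i j`, against injectivity.
    have hauv : swap a b = swap u v := by
      have h4 : a = u ∨ b = u := by
        by_contra! hcon
        exact h2 (hdisj hap hcon.1 hbp hcon.2)
      have h5 : a = v ∨ b = v := by
        by_contra! hcon
        exact h3 (hdisj hap hcon.1 hbp hcon.2)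
      rcases h4 with rfl | rfl
      · rcases h5 with rfl | rfl
        · exact absurd rfl huv
        · rfl
      · rcases h5 with rfl | rfl
        · exact swap_comm _ _
        · exact absurd rfl huv
    have h6 : α (swap i j) = swap u v := by
      rw [← swap_mul_swap_mul_swap hzj.symm hij.symm, map_mul, map_mul,
        swap_comm j z, hu, hv, swap_comm p v, swap_mul_swap_mul_swap hpv.symm huv.symm]
    have h7 : swap z k = swap i j := hα (by rw [h1, hauv, h6])
    have h8 := congrArg (fun p : Perm (Fin n) => p z) h7
    simp only [swap_apply_left, swap_apply_of_ne_of_ne hzi hzj] at h8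
    exact hk h8
  choose! q hqp hq using hstar
  let s : Fin n → Fin n := fun k => if k = z then p else q k
  have hs : Function.Injective s := by
    intro k l hkl
    by_cases hk : k = z <;> by_cases hl : l = z
    · rw [hk, hl]
    · simp only [s, hk, hl, if_true, if_false] at hkl
      exact absurd hkl.symm (hqp l hl)
    · simp only [s, hk, hl, if_true, if_false] at hkl
      exact absurd hkl (hqp k hk)
    · simp only [s, hk, hl, if_false] at hkl
      have h1 : swap z k = swap z l := hα (by rw [hq k hk, hq l hl, hkl])
      simpa using congrArg (fun p : Perm (Fin n) => p z) h1
  let τ : Perm (Fin n) := Equiv.ofBijective s (Finite.injective_iff_bijective.1 hs)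
  have hτz : τ z = p := by simp [τ, s]
  have hτ : ∀ k, k ≠ z → τ k = q k := fun k hk => by simp [τ, s, hk]
  refine ⟨τ, fun σ => ?_⟩
  suffices h : α = (MulAut.conj τ).toMonoidHom by rw [h]; rfl
  have hz : ∀ k, k ≠ z → α (swap z k) = τ * swap z k * τ⁻¹ := by
    intro k hk
    rw [← swap_apply_apply, hτz, hτ k hk, hq k hk]
  refine MonoidHom.eq_of_eqOn_dense closure_isSwap ?_
  rintro _ ⟨k, l, hkl, rfl⟩
  show α (swap k l) = τ * swap k l * τ⁻¹
  by_cases hk : k = z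
  · subst hk; exact hz l hkl.symm
  by_cases hl : l = z
  · subst hl; rw [swap_comm]; exact hz k hkl
  rw [← swap_mul_swap_mul_swap hl hkl.symm, swap_comm l z]
  simp only [map_mul, hz k hk, hz l hl]
  group

end Equiv.Perm

/-! ### Counting commuting pairs of involutions -/

section CommutingInvolutions

/-- Ordered pairs of commuting elements `x`, `y` with `x² = y² = 1`. -/
def commutingInvolutions (G : Type*) [Group G] : Set (G × G) :=
  {p | p.1 * p.1 = 1 ∧ p.2 * p.2 = 1 ∧ p.1 * p.2 = p.2 * p.1}

/-- The four elements generated by a commuting pair of involutions. -/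
def kleinElement {G : Type*} [Group G] (p : G × G) (k : Bool × Bool) : G :=
  cond k.1 p.1 1 * cond k.2 p.2 1

theorem kleinElement_mul {G : Type*} [Group G] {p : G × G}
    (hp : p ∈ commutingInvolutions G) (k l : Bool × Bool) :
    kleinElement p k * kleinElement p l = kleinElement p (xor k.1 l.1, xor k.2 l.2) := by
  obtain ⟨a, b⟩ := p
  obtain ⟨ha, hb, hab⟩ := hp
  simp only at ha hb hab
  have ha' : ∀ x, a * (a * x) = x := fun x => by rw [← mul_assoc, ha, one_mul]
  have hab' : ∀ x, b * (a * x) = a * (b * x) := fun x => by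
    rw [← mul_assoc, ← hab, mul_assoc]
  obtain ⟨k1, k2⟩ := k
  obtain ⟨l1, l2⟩ := l
  cases k1 <;> cases k2 <;> cases l1 <;> cases l2 <;>
    simp [kleinElement, mul_assoc, ha, hb, ha', ← hab, hab']

/-- Orbit representatives `r` of the group generated by a commuting pair of involutions, together
with an element `g x` carrying `r x` to `x`. -/
theorem exists_orbit_data {n : ℕ} {p : Equiv.Perm (Fin n) × Equiv.Perm (Fin n)}
    (hp : p ∈ commutingInvolutions (Equiv.Perm (Fin n))) :
    ∃ (r : Fin n → Fin n) (g : Fin n → Bool × Bool),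
      (∀ x, r (r x) = r x) ∧ (∀ k x, r (kleinElement p k x) = r x) ∧
      ∀ x, kleinElement p (g x) (r x) = x := by
  let S : Fin n → Finset (Fin n) := fun x => Finset.univ.image fun k => kleinElement p k x
  have hS : ∀ x, (S x).Nonempty := fun x => Finset.univ_nonempty.image _
  have hSk : ∀ k x, S (kleinElement p k x) = S x := by
    intro k x
    ext y
    simp only [S, Finset.mem_image, Finset.mem_univ, true_and, ← Equiv.Perm.mul_apply,
      kleinElement_mul hp]
    constructor
    · rintro ⟨l, rfl⟩
      exact ⟨_, rfl⟩
    · rintro ⟨l, rfl⟩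
      refine ⟨(xor l.1 k.1, xor l.2 k.2), ?_⟩
      simp
  -- The minimum depends only on the orbit. The `g` chosen below carries `x` to `r x`, and also
  -- back, since each Klein element is its own inverse.
  let r : Fin n → Fin n := fun x => (S x).min' (hS x)
  have hr : ∀ x, ∃ k, kleinElement p k x = r x := by
    intro x
    have := (S x).min'_mem (hS x)
    simpa [S] using this
  have hrk : ∀ k x, r (kleinElement p k x) = r x := by
    intro k x
    simp only [r, hSk]
  choose g hg using hr
  refine ⟨r, g, fun x => ?_, hrk, fun x => ?_⟩
  · conv_lhs => rw [← hg x, hrk]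
  · rw [← hg x, ← Equiv.Perm.mul_apply, kleinElement_mul hp]
    simp [kleinElement]

/-- Choose the set of moved points in at most `2 ^ n` ways, then the values on it; it has at most
`3n/4` elements. -/
theorem card_functions_with_many_fixed_points_le (n : ℕ) :
    (Finset.univ.filter fun r : Fin n → Fin n =>
      n ≤ 4 * (Finset.univ.filter fun x => r x = x).card).card ≤ 2 ^ n * n ^ (3 * n / 4) := by
  classical
  let T : Finset (Fin n) → Finset (Fin n → Fin n) := fun s =>
    Finset.univ.filter fun r => s = Finset.univ.filter (fun x => r x ≠ x) ∧ 4 * s.card ≤ 3 * n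
  have hT : ∀ s, (T s).card ≤ n ^ (3 * n / 4) := by
    intro s
    by_cases hs : 4 * s.card ≤ 3 * n
    · have h1 : (T s).card ≤ Fintype.card (s → Fin n) := by
        rw [← Finset.card_univ]
        refine Finset.card_le_card_of_injOn (fun r x => r x) (fun _ _ => Finset.mem_univ _) ?_
        intro r hr r' hr' h
        simp only [T, Finset.coe_filter, Finset.mem_univ, true_and, Set.mem_ofPred_eq] at hr hr'
        funext x
        by_cases hx : x ∈ s
        · exact congrFun h ⟨x, hx⟩
        · have h1 : x ∉ Finset.univ.filter (fun x => r x ≠ x) := hr.1 ▸ hx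
          have h2 : x ∉ Finset.univ.filter (fun x => r' x ≠ x) := hr'.1 ▸ hx
          simp only [Finset.mem_filter, Finset.mem_univ, true_and, not_not] at h1 h2
          rw [h1, h2]
      refine h1.trans ?_
      rw [Fintype.card_fun, Fintype.card_fin, Fintype.card_coe]
      rcases Nat.eq_zero_or_pos n with rfl | hn
      · have : s.card = 0 := by omega
        simp [this]
      · exact Nat.pow_le_pow_right hn (by omega)
    · have : T s = ∅ := Finset.filter_eq_empty_iff.2 fun r _ h => hs h.2
      simp [this]
  calc _ ≤ ((Finset.univ : Finset (Finset (Fin n))).biUnion T).card := by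
        refine Finset.card_le_card fun r hr => ?_
        simp only [Finset.mem_filter, Finset.mem_univ, true_and] at hr
        simp only [T, Finset.mem_biUnion, Finset.mem_filter, Finset.mem_univ, true_and]
        refine ⟨_, rfl, ?_⟩
        have := Finset.card_filter_add_card_filter_not (s := (Finset.univ : Finset (Fin n)))
          (fun x => r x = x)
        rw [Finset.card_univ, Fintype.card_fin] at this
        simp only [ne_eq]
        omega
    _ ≤ ∑ s : Finset (Fin n), (T s).card := Finset.card_biUnion_le
    _ ≤ ∑ _s : Finset (Fin n), n ^ (3 * n / 4) := Finset.sum_le_sum fun s _ => hT s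
    _ = 2 ^ n * n ^ (3 * n / 4) := by simp

/-- Orbits have at most four elements, so the representative map `r` fixes at least `n/4` points.
Since a point is recovered from its representative and label, the pair is encoded by `r`, the labels
`g`, and the labels of the two images of each point: three factors `4 ^ n` besides the count of `r`.
-/
theorem card_commutingInvolutions_perm_le (n : ℕ) :
    Nat.card (commutingInvolutions (Equiv.Perm (Fin n))) ≤ 2 ^ (7 * n) * n ^ (3 * n / 4) := by
  classical
  have hdata := fun p : commutingInvolutions (Equiv.Perm (Fin n)) => exists_orbit_data p.2
  choose r g hidem hr hg using hdata
  let R := Finset.univ.filter fun r : Fin n → Fin n =>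
      n ≤ 4 * (Finset.univ.filter fun x => r x = x).card
  have hR : ∀ p, r p ∈ R := by
    intro p
    simp only [R, Finset.mem_filter, Finset.mem_univ, true_and]
    have : Fintype.card (Fin n) ≤
        ((Finset.univ : Finset (Bool × Bool)) ×ˢ
          (Finset.univ.filter fun x => r p x = x)).card := by
      rw [← Finset.card_univ]
      refine Finset.card_le_card_of_injOn (fun x => (g p x, r p x)) (fun x _ => ?_) ?_
      · simp [hidem]
      · intro x _ y _ h
        simp only [Prod.mk.injEq] at h
        rw [← hg p x, ← hg p y, h.1, h.2]
    simpa using this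
  let F : commutingInvolutions (Equiv.Perm (Fin n)) →
      R × (Fin n → Bool × Bool) × (Fin n → Bool × Bool) × (Fin n → Bool × Bool) := fun p =>
    (⟨r p, hR p⟩, g p, fun x => g p (p.1.1 x), fun x => g p (p.1.2 x))
  have hF : Function.Injective F := by
    intro p q h
    simp only [F, Prod.mk.injEq, Subtype.mk.injEq] at h
    obtain ⟨h1, h2, h3, h4⟩ := h
    have key : ∀ k x, g p (kleinElement p.1 k x) = g q (kleinElement q.1 k x) →
        kleinElement p.1 k x = kleinElement q.1 k x := by
      intro k x h
      have h5 : r p (kleinElement q.1 k x) = r p x := by rw [h1, hr]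
      rw [← hg p (kleinElement q.1 k x), h5, congrFun h2, ← h, ← hr p k x, hg]
    refine Subtype.ext (Prod.ext (Equiv.ext fun x => ?_) (Equiv.ext fun x => ?_))
    · simpa [kleinElement] using key (true, false) x (by simpa [kleinElement] using congrFun h3 x)
    · simpa [kleinElement] using key (false, true) x (by simpa [kleinElement] using congrFun h4 x)
  refine (Nat.card_le_card_of_injective F hF).trans ?_
  have hRc : R.card ≤ 2 ^ n * n ^ (3 * n / 4) := card_functions_with_many_fixed_points_le n
  simp only [Nat.card_eq_fintype_card, Fintype.card_coe, Fintype.card_fun,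
    Fintype.card_prod, Fintype.card_bool, Fintype.card_fin]
  calc R.card * ((2 * 2) ^ n * ((2 * 2) ^ n * (2 * 2) ^ n))
      ≤ (2 ^ n * n ^ (3 * n / 4)) * ((2 * 2) ^ n * ((2 * 2) ^ n * (2 * 2) ^ n)) :=
        Nat.mul_le_mul_right _ hRc
    _ = 2 ^ (7 * n) * n ^ (3 * n / 4) := by
        rw [show 7 * n = n + n + n + n + n + n + n by ring]
        simp only [mul_pow, pow_add]
        ring

theorem card_commutingInvolutions_signedPerm_le (n : ℕ) :
    Nat.card (commutingInvolutions (SignedPerm n)) ≤ 2 ^ (9 * n) * n ^ (3 * n / 4) := by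
  let F : commutingInvolutions (SignedPerm n) →
      (Fin n → ℤˣ) × (Fin n → ℤˣ) × commutingInvolutions (Equiv.Perm (Fin n)) := fun p =>
    (p.1.1.left, p.1.2.left, ⟨(p.1.1.right, p.1.2.right),
      congrArg SemidirectProduct.right p.2.1, congrArg SemidirectProduct.right p.2.2.1,
      congrArg SemidirectProduct.right p.2.2.2⟩)
  have hF : Function.Injective F := by
    intro p q h
    simp only [F, Prod.mk.injEq] at h
    obtain ⟨h1, h2, h3⟩ := h
    have h4 := congrArg Subtype.val h3
    simp only [Prod.mk.injEq] at h4
    exact Subtype.ext (Prod.ext (SemidirectProduct.ext h1 h4.1) (SemidirectProduct.ext h2 h4.2))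
  refine (Nat.card_le_card_of_injective F hF).trans ?_
  rw [Nat.card_prod, Nat.card_prod]
  have h1 : Nat.card (Fin n → ℤˣ) = 2 ^ n := by simp [Nat.card_eq_fintype_card]
  rw [h1]
  calc 2 ^ n * (2 ^ n * Nat.card (commutingInvolutions (Equiv.Perm (Fin n))))
      ≤ 2 ^ n * (2 ^ n * (2 ^ (7 * n) * n ^ (3 * n / 4))) :=
        Nat.mul_le_mul_left _ (Nat.mul_le_mul_left _ (card_commutingInvolutions_perm_le n))
    _ = 2 ^ (9 * n) * n ^ (3 * n / 4) := by
        rw [show 9 * n = n + n + 7 * n by ring, pow_add, pow_add]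
        ring

end CommutingInvolutions

/-! ### Endomorphisms with non-injective permutation part -/

namespace SignedPerm

open Equiv

theorem mulAutArrow_apply_perm {n : ℕ} (σ : Perm (Fin n)) (ε : Fin n → ℤˣ) (i : Fin n) :
    (mulAutArrow σ ε : Fin n → ℤˣ) i = ε (σ⁻¹ i) := rfl

theorem mulAutArrow_mulSingle {n : ℕ} (σ : Perm (Fin n)) (i : Fin n) (x : ℤˣ) :
    (mulAutArrow σ (Pi.mulSingle i x) : Fin n → ℤˣ) = Pi.mulSingle (σ i) x := by
  funext j
  rw [mulAutArrow_apply_perm, Pi.mulSingle_apply, Pi.mulSingle_apply]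
  exact if_congr (by rw [Perm.inv_eq_iff_eq]) rfl rfl

/-- The action of `f` on the symmetric group, modulo signs. -/
def permPart {n : ℕ} (f : Monoid.End (SignedPerm n)) : Perm (Fin n) →* Perm (Fin n) :=
  SemidirectProduct.rightHom.comp (MonoidHom.comp f SemidirectProduct.inr)

theorem permPart_apply {n : ℕ} (f : Monoid.End (SignedPerm n)) (σ : Perm (Fin n)) :
    permPart f σ = (f (SemidirectProduct.inr σ)).right := rfl

/-- A nontrivial normal subgroup of `S_n` contains the alternating group, so `f` sends the latter
into the abelian group of signs; being perfect, it is killed. -/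
theorem map_inr_eq_one_of_not_injective {n : ℕ} (hn : 5 ≤ n) {f : Monoid.End (SignedPerm n)}
    (hf : ¬ Function.Injective (permPart f)) {σ : Perm (Fin n)} (hσ : Perm.sign σ = 1) :
    f (SemidirectProduct.inr σ) = 1 := by
  have hcard : 5 ≤ Nat.card (Fin n) := by simpa using hn
  have hker : alternatingGroup (Fin n) ≤ (permPart f).ker := by
    refine Perm.alternatingGroup_le_of_normal hcard ?_
    rwa [Subgroup.nontrivial_iff_ne_bot, Ne, MonoidHom.ker_eq_bot_iff]
  have hright : ∀ τ : alternatingGroup (Fin n),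
      (f (SemidirectProduct.inr (τ : Perm (Fin n)))).right = 1 := fun τ => hker τ.2
  let h : alternatingGroup (Fin n) →* (Fin n → ℤˣ) :=
    { toFun := fun τ => (f (SemidirectProduct.inr (τ : Perm (Fin n)))).left
      map_one' := by simp
      map_mul' := fun τ ρ => by
        rw [Subgroup.coe_mul, map_mul, map_mul, SemidirectProduct.mul_left, hright, map_one,
          MulAut.one_apply] }
  have hh : h ⟨σ, hσ⟩ = 1 := by
    have := Abelianization.commutator_subset_ker h
    rw [commutator_alternatingGroup_eq_top hcard] at this
    exact this (Subgroup.mem_top _)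
  exact SemidirectProduct.ext hh (hright ⟨σ, hσ⟩)

/-- An endomorphism killing the alternating group is determined by two commuting involutions. -/
theorem card_not_injective_permPart_le {n : ℕ} (hn : 5 ≤ n) :
    Nat.card {f : Monoid.End (SignedPerm n) // ¬ Function.Injective (permPart f)} ≤
      Nat.card (commutingInvolutions (SignedPerm n)) := by
  let z : Fin n := ⟨0, by omega⟩
  let a : Fin n := ⟨1, by omega⟩
  let b : Fin n := ⟨2, by omega⟩
  have hza : z ≠ a := by simp [z, a]
  have hzb : z ≠ b := by simp [z, b]
  have hab : a ≠ b := by simp [a, b]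
  -- The sign flip at `z` and a transposition fixing `z` commute. All flips are conjugate to `e`
  -- under the killed alternating group, and `s` together with that group generates `S_n`.
  let e : SignedPerm n := SemidirectProduct.inl (Pi.mulSingle z (-1))
  let s : SignedPerm n := SemidirectProduct.inr (swap a b)
  have hee : e * e = 1 := by
    rw [← map_mul, ← Pi.mulSingle_mul]
    simp
  have hss : s * s = 1 := by
    rw [← map_mul, swap_mul_self, map_one]
  have hes : e * s = s * e := by
    have : (SemidirectProduct.inl (mulAutArrow (swap a b) (Pi.mulSingle z (-1))) :
        SignedPerm n) = _ := SemidirectProduct.inl_aut _ _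
    rw [mulAutArrow_mulSingle, swap_apply_of_ne_of_ne hza hzb] at this
    show SemidirectProduct.inl (Pi.mulSingle z (-1)) * s = s * e
    rw [this, mul_assoc, ← map_mul]
    simp [s, e]
  let F : {f : Monoid.End (SignedPerm n) // ¬ Function.Injective (permPart f)} →
      commutingInvolutions (SignedPerm n) := fun f =>
    ⟨(f.1 e, f.1 s), by
      refine ⟨?_, ?_, ?_⟩
      · rw [← map_mul, hee, map_one]
      · rw [← map_mul, hss, map_one]
      · rw [← map_mul, hes, map_mul]⟩
  refine Nat.card_le_card_of_injective F ?_
  intro f g hfg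
  have hfg' := congrArg Subtype.val hfg
  simp only [F, Prod.mk.injEq] at hfg'
  obtain ⟨he, hs⟩ := hfg'
  have key : ∀ (f : {f : Monoid.End (SignedPerm n) // ¬ Function.Injective (permPart f)})
      (i : Fin n), f.1 (SemidirectProduct.inl (Pi.mulSingle i (-1))) = f.1 e := by
    intro f i
    obtain ⟨σ, hσ, hσi⟩ : ∃ σ : Perm (Fin n), Perm.sign σ = 1 ∧ σ z = i := by
      by_cases hi : z = i
      · exact ⟨1, by simp, hi⟩
      · obtain ⟨u, hu⟩ := Finset.exists_mem_notMem_of_card_lt_card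
          (s := {z, i}) (t := (Finset.univ : Finset (Fin n)))
          (lt_of_le_of_lt Finset.card_le_two (by simp; omega))
        obtain ⟨v, hv⟩ := Finset.exists_mem_notMem_of_card_lt_card
          (s := {z, i, u}) (t := (Finset.univ : Finset (Fin n)))
          (lt_of_le_of_lt Finset.card_le_three (by simp; omega))
        simp only [Finset.mem_univ, true_and, Finset.mem_insert, Finset.mem_singleton,
          not_or] at hu hv
        refine ⟨swap z i * swap u v, ?_, ?_⟩
        · rw [Perm.sign_mul, Perm.sign_swap hi, Perm.sign_swap (Ne.symm hv.2.2)]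
          simp
        · rw [Perm.mul_apply, swap_apply_of_ne_of_ne (Ne.symm hu.1) (Ne.symm hv.1),
            swap_apply_left]
    rw [← hσi, ← mulAutArrow_mulSingle, SemidirectProduct.inl_aut, map_mul, map_mul,
      map_inr_eq_one_of_not_injective hn f.2 hσ,
      map_inr_eq_one_of_not_injective hn f.2 (σ := σ⁻¹) (by simp [hσ]), one_mul, mul_one]
  refine Subtype.ext (SemidirectProduct.hom_ext ?_ ?_)
  · refine MonoidHom.pi_ext fun i x => ?_
    rcases Int.units_eq_one_or x with rfl | rfl
    · simp
    · exact (key f i).trans (he.trans (key g i).symm)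
  · refine MonoidHom.ext fun σ => ?_
    show f.1 (SemidirectProduct.inr σ) = g.1 (SemidirectProduct.inr σ)
    rcases Int.units_eq_one_or (Perm.sign σ) with hσ | hσ
    · rw [map_inr_eq_one_of_not_injective hn f.2 hσ, map_inr_eq_one_of_not_injective hn g.2 hσ]
    · have hσ' : Perm.sign (σ * swap a b) = 1 := by
        rw [Perm.sign_mul, hσ, Perm.sign_swap hab]
        simp
      have hdec : (SemidirectProduct.inr σ : SignedPerm n) =
          SemidirectProduct.inr (σ * swap a b) * s := by
        rw [← map_mul, mul_assoc, swap_mul_self, mul_one]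
      rw [hdec, map_mul f.1, map_mul g.1, map_inr_eq_one_of_not_injective hn f.2 hσ',
        map_inr_eq_one_of_not_injective hn g.2 hσ', hs]

theorem factorial_le_imageOrder {n : ℕ} {f : Monoid.End (SignedPerm n)}
    (hf : Function.Injective (permPart f)) : n ! ≤ imageOrder n f := by
  have h1 : Nat.card (Perm (Fin n)) = n ! := by
    rw [Nat.card_eq_fintype_card, Fintype.card_perm, Fintype.card_fin]
  rw [← h1]
  refine Nat.card_le_card_of_injective
    (fun σ => (⟨f (SemidirectProduct.inr σ), ⟨_, rfl⟩⟩ : MonoidHom.range f)) fun σ τ h => hf ?_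
  exact congrArg SemidirectProduct.right (congrArg Subtype.val h)

theorem card_eq (n : ℕ) : Nat.card (SignedPerm n) = 2 ^ n * n ! := by
  rw [SemidirectProduct.card]
  simp [Nat.card_eq_fintype_card, Fintype.card_perm]

theorem imageOrder_le (n : ℕ) (f : Monoid.End (SignedPerm n)) :
    imageOrder n f ≤ 2 ^ n * n ! := by
  rw [← card_eq]
  exact Nat.card_le_card_of_injective _ Subtype.val_injective

end SignedPerm

/-! ### Centralisers and characters of the symmetric group -/

namespace Equiv.Perm

/-- The centraliser of a point stabiliser is trivial. This gives both the uniqueness of a conjugator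
and the inclusion `f(N) ⊆ N`. -/
theorem eq_one_of_commute_swap {n : ℕ} (hn : 4 ≤ n) {y : Perm (Fin n)} (i : Fin n)
    (h : ∀ j k, j ≠ i → k ≠ i → Commute y (swap j k)) : y = 1 := by
  have hfix : ∀ j, j ≠ i → y j = j := by
    intro j hj
    by_contra hyj
    obtain ⟨l, -, hl⟩ := Finset.exists_mem_notMem_of_card_lt_card
      (s := {i, j, y j}) (t := (Finset.univ : Finset (Fin n)))
      (lt_of_le_of_lt Finset.card_le_three (by simp; omega))
    simp only [Finset.mem_insert, Finset.mem_singleton, not_or] at hl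
    have h1 := congrArg (fun p : Perm (Fin n) => p j) (h j l hj hl.1)
    simp only [coe_mul, Function.comp_apply, swap_apply_left,
      swap_apply_of_ne_of_ne hyj (Ne.symm hl.2.2)] at h1
    exact hl.2.1 (y.injective h1)
  ext j
  by_cases hj : j = i
  · subst hj
    by_contra hne
    have hne' : y j ≠ j := fun h => hne (by rw [h, one_apply])
    exact hne' (y.injective (hfix _ hne'))
  · rw [hfix j hj, one_apply]

theorem conj_injective {n : ℕ} (hn : 4 ≤ n) {σ τ : Perm (Fin n)}
    (h : ∀ ρ, σ * ρ * σ⁻¹ = τ * ρ * τ⁻¹) : σ = τ := by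
  have : τ⁻¹ * σ = 1 := by
    refine eq_one_of_commute_swap hn ⟨0, by omega⟩ fun j k _ _ => ?_
    have h1 := h (swap j k)
    rw [mul_inv_eq_iff_eq_mul] at h1
    show τ⁻¹ * σ * _ = _ * (τ⁻¹ * σ)
    rw [mul_assoc, h1]
    group
  rw [inv_mul_eq_one] at this
  exact this.symm

theorem hom_units_eq_sign_pow {α : Type*} [Fintype α] [DecidableEq α] (χ : Perm α →* ℤˣ) :
    ∃ a : Bool, ∀ σ, χ σ = sign σ ^ a.toNat := by
  by_cases hχ : Function.Surjective χ
  · exact ⟨true, fun σ => by rw [eq_sign_of_surjective_hom hχ]; simp⟩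
  · refine ⟨false, fun σ => ?_⟩
    rcases Int.units_eq_one_or (χ σ) with h | h
    · simpa using h
    · refine absurd (fun x => ?_) hχ
      rcases Int.units_eq_one_or x with rfl | rfl
      · exact ⟨1, map_one χ⟩
      · exact ⟨σ, h⟩

theorem decomposeFin_symm_zero_mul {m : ℕ} (e e' : Perm (Fin m)) :
    decomposeFin.symm (0, e * e') = decomposeFin.symm (0, e) * decomposeFin.symm (0, e') := by
  ext x
  refine Fin.cases ?_ (fun x => ?_) x
  · simp [decomposeFin_symm_apply_zero]
  · simp [decomposeFin_symm_apply_succ]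

end Equiv.Perm

/-! ### Cocycles and equivariant endomorphisms of the sign group -/

namespace SignedPerm

open Equiv

theorem units_mul_self (x : ℤˣ) : x * x = 1 := by
  rw [← sq, Int.units_sq]

theorem exists_eq_neg_one_pow (x : ℤˣ) : ∃ b : Bool, x = (-1) ^ b.toNat := by
  rcases Int.units_eq_one_or x with rfl | rfl
  · exact ⟨false, by simp⟩
  · exact ⟨true, by simp⟩

theorem neg_one_pow_toNat_injective :
    Function.Injective fun b : Bool => (-1 : ℤˣ) ^ b.toNat := by
  decide

/-- Shapiro's lemma by hand: the sign module is induced from the stabiliser of `0`, so the class of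
`F` is a character of that stabiliser, hence a power of `sign`. The quotient `G` is trivial there at
coordinate `0`, and so is the coboundary of `j ↦ G (swap 0 j) j`. -/
theorem cocycle_eq {m : ℕ} {F : Perm (Fin (m + 1)) → Fin (m + 1) → ℤˣ}
    (hF : ∀ σ ρ i, F (σ * ρ) i = F σ i * F ρ (σ⁻¹ i)) :
    ∃ (a : Bool) (u : Fin (m + 1) → ℤˣ), u 0 = 1 ∧
      ∀ σ i, F σ i = u i * Perm.sign σ ^ a.toNat * u (σ⁻¹ i) := by
  have hF1 : ∀ i, F 1 i = 1 := fun i => by simpa using hF 1 1 i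
  have hdec0 : ∀ e : Perm (Fin m), (Perm.decomposeFin.symm (0, e))⁻¹ 0 = 0 := fun e => by
    rw [Perm.inv_eq_iff_eq, Perm.decomposeFin_symm_apply_zero]
  let χ : Perm (Fin m) →* ℤˣ :=
    { toFun := fun e => F (Perm.decomposeFin.symm (0, e)) 0
      map_one' := by rw [Perm.decomposeFin_symm_of_one, swap_self]; exact hF1 0
      map_mul' := fun e e' => by rw [Perm.decomposeFin_symm_zero_mul, hF, hdec0] }
  obtain ⟨a, ha⟩ := Perm.hom_units_eq_sign_pow χ
  have hstab : ∀ ρ : Perm (Fin (m + 1)), ρ 0 = 0 → F ρ 0 = Perm.sign ρ ^ a.toNat := by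
    intro ρ hρ
    obtain ⟨⟨p, e⟩, rfl⟩ := Perm.decomposeFin.symm.surjective ρ
    rw [Perm.decomposeFin_symm_apply_zero] at hρ
    subst hρ
    rw [Perm.decomposeFin.symm_sign, if_pos rfl, one_mul]
    exact ha e
  let G : Perm (Fin (m + 1)) → Fin (m + 1) → ℤˣ := fun σ i => F σ i * Perm.sign σ ^ a.toNat
  have hG : ∀ σ ρ i, G (σ * ρ) i = G σ i * G ρ (σ⁻¹ i) := by
    intro σ ρ i
    simp only [G, hF, Perm.sign_mul, mul_pow]
    ac_rfl
  have hGstab : ∀ ρ : Perm (Fin (m + 1)), ρ 0 = 0 → G ρ 0 = 1 := by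
    intro ρ hρ
    simp only [G, hstab ρ hρ, units_mul_self]
  have hGF : ∀ σ i, F σ i = G σ i * Perm.sign σ ^ a.toNat := by
    intro σ i
    simp only [G, mul_assoc, units_mul_self, mul_one]
  refine ⟨a, fun j => G (swap 0 j) j, ?_, fun σ j => ?_⟩
  · exact hGstab _ (by simp)
  · have h0 : (swap 0 j * σ * swap 0 (σ⁻¹ j)) 0 = 0 := by simp
    have h1 : σ * swap 0 (σ⁻¹ j) = swap 0 j * (swap 0 j * σ * swap 0 (σ⁻¹ j)) := by
      rw [mul_assoc (swap 0 j) σ, ← mul_assoc (swap 0 j), swap_mul_self, one_mul]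
    have h2 : G σ j * G (swap 0 (σ⁻¹ j)) (σ⁻¹ j) = G (swap 0 j) j := by
      rw [← hG, h1, hG, swap_inv, swap_apply_right, hGstab _ h0, mul_one]
    beta_reduce
    rw [hGF, ← h2]
    calc G σ j * Perm.sign σ ^ a.toNat = G σ j * Perm.sign σ ^ a.toNat *
          (G (swap 0 (σ⁻¹ j)) (σ⁻¹ j) * G (swap 0 (σ⁻¹ j)) (σ⁻¹ j)) := by
          rw [units_mul_self, mul_one]
      _ = _ := by ac_rfl

/-- The equivariant endomorphism `ε ↦ ε ^ b * (∏ ε) ^ d` of the group of sign vectors. -/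
def signHom (n : ℕ) (b d : Bool) : (Fin n → ℤˣ) →* (Fin n → ℤˣ) where
  toFun ε := fun i => ε i ^ b.toNat * (∏ j, ε j) ^ d.toNat
  map_one' := by
    funext i
    simp
  map_mul' ε δ := by
    funext i
    simp only [Pi.mul_apply, Finset.prod_mul_distrib, mul_pow]
    ac_rfl

theorem signHom_apply {n : ℕ} (b d : Bool) (ε : Fin n → ℤˣ) (i : Fin n) :
    signHom n b d ε i = ε i ^ b.toNat * (∏ j, ε j) ^ d.toNat := rfl

theorem signHom_mulSingle {n : ℕ} (b d : Bool) (i j : Fin n) :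
    signHom n b d (Pi.mulSingle i (-1)) j =
      (if j = i then (-1) ^ b.toNat else 1) * (-1) ^ d.toNat := by
  rw [signHom_apply, Finset.prod_pi_mulSingle', if_pos (Finset.mem_univ i), Pi.mulSingle_apply]
  split_ifs <;> simp

theorem signHom_smul {n : ℕ} (b d : Bool) (σ : Perm (Fin n)) (ε : Fin n → ℤˣ) :
    signHom n b d (mulAutArrow σ ε) = mulAutArrow σ (signHom n b d ε) := by
  funext i
  rw [signHom_apply, mulAutArrow_apply_perm, mulAutArrow_apply_perm, signHom_apply]
  congr 2
  exact Equiv.prod_comp σ⁻¹ ε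

/-- The matrix of `θ` is invariant under simultaneous permutation of rows and columns, so it has one
diagonal and one off-diagonal value. -/
theorem eq_signHom_of_equivariant {n : ℕ} (hn : 2 ≤ n) (θ : (Fin n → ℤˣ) →* (Fin n → ℤˣ))
    (hθ : ∀ (σ : Perm (Fin n)) ε, θ (mulAutArrow σ ε) = mulAutArrow σ (θ ε)) :
    ∃ b d, θ = signHom n b d := by
  let z : Fin n := ⟨0, by omega⟩
  let o : Fin n := ⟨1, by omega⟩
  have hzo : z ≠ o := by simp [z, o]
  let t : Fin n → Fin n → ℤˣ := fun i j => θ (Pi.mulSingle i (-1)) j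
  have ht : ∀ (σ : Perm (Fin n)) i j, t (σ i) (σ j) = t i j := by
    intro σ i j
    simp only [t]
    rw [← mulAutArrow_mulSingle, hθ, mulAutArrow_apply_perm, Perm.inv_eq_iff_eq.2 rfl]
  have hdiag : ∀ i, t i i = t z z := fun i => by
    have := ht (swap i z) i i
    rwa [swap_apply_left, eq_comm] at this
  have hoff : ∀ i j, j ≠ i → t i j = t z o := by
    intro i j hij
    have h1 := ht (swap (swap i z j) o * swap i z) i j
    rw [Perm.mul_apply, Perm.mul_apply, swap_apply_left, swap_apply_left] at h1
    rw [← h1, swap_apply_of_ne_of_ne _ hzo]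
    intro h
    have := (swap i z).injective (h.symm.trans (swap_apply_left i z).symm)
    exact hij this
  obtain ⟨d, hd⟩ := exists_eq_neg_one_pow (t z o)
  obtain ⟨b, hb⟩ := exists_eq_neg_one_pow (t z z * t z o)
  refine ⟨b, d, MonoidHom.pi_ext fun i x => ?_⟩
  rcases Int.units_eq_one_or x with rfl | rfl
  · simp
  · funext j
    rw [signHom_mulSingle]
    show t i j = _
    split_ifs with hj
    · rw [hj, hdiag, ← hb, ← hd, mul_assoc, units_mul_self, mul_one]
    · rw [hoff i j hj, hd, one_mul]

end SignedPerm

/-! ### Normal form and exact count in the injective case -/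

namespace SignedPerm

open Equiv

/-- The endomorphism `(ε, σ) ↦ (ε ^ b * (∏ ε) ^ d * sign σ ^ a, σ)`. -/
def twist (n : ℕ) (a b d : Bool) : Monoid.End (SignedPerm n) where
  toFun x := ⟨signHom n b d x.left * fun _ => Perm.sign x.right ^ a.toNat, x.right⟩
  map_one' := by
    refine SemidirectProduct.ext ?_ rfl
    funext i
    simp
  map_mul' x y := by
    refine SemidirectProduct.ext ?_ rfl
    funext i
    simp only [SemidirectProduct.mul_left, SemidirectProduct.mul_right, map_mul, signHom_smul,
      Pi.mul_apply, mulAutArrow_apply_perm, mul_pow]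
    ac_rfl

theorem twist_left {n : ℕ} (a b d : Bool) (x : SignedPerm n) (i : Fin n) :
    (twist n a b d x).left i = signHom n b d x.left i * Perm.sign x.right ^ a.toNat := rfl

theorem twist_right {n : ℕ} (a b d : Bool) (x : SignedPerm n) :
    (twist n a b d x).right = x.right := rfl

theorem perm_apply_inv_apply {n : ℕ} (σ : Perm (Fin n)) (i : Fin n) : σ (σ⁻¹ i) = i :=
  σ.apply_symm_apply i

/-- A twist followed by conjugation by `c`. -/
def conjTwist {n : ℕ} (c : SignedPerm n) (a b d : Bool) : Monoid.End (SignedPerm n) :=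
  (MulAut.conj c).toMonoidHom.comp (twist n a b d)

theorem conjTwist_inr {n : ℕ} (c : SignedPerm n) (a b d : Bool) (σ : Perm (Fin n)) :
    conjTwist c a b d (SemidirectProduct.inr σ) =
      ⟨fun i => c.left i * Perm.sign σ ^ a.toNat *
        c.left ((c.right * σ * c.right⁻¹)⁻¹ i), c.right * σ * c.right⁻¹⟩ := by
  refine SemidirectProduct.ext ?_ rfl
  funext i
  show (c * twist n a b d (SemidirectProduct.inr σ) * c⁻¹).left i = _
  simp only [SemidirectProduct.mul_left, SemidirectProduct.mul_right, SemidirectProduct.inv_left,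
    Pi.mul_apply, mulAutArrow_apply_perm, Pi.inv_apply, Int.units_inv_eq_self, twist_left, twist_right,
    SemidirectProduct.left_inr, SemidirectProduct.right_inr,
    map_one, Pi.one_apply, one_mul, inv_inv, mul_inv_rev, Perm.mul_apply]

theorem conjTwist_inl {n : ℕ} (c : SignedPerm n) (a b d : Bool) (ε : Fin n → ℤˣ) :
    conjTwist c a b d (SemidirectProduct.inl ε) =
      SemidirectProduct.inl (mulAutArrow c.right (signHom n b d ε)) := by
  refine SemidirectProduct.ext ?_ ?_
  · funext i
    show (c * twist n a b d (SemidirectProduct.inl ε) * c⁻¹).left i = _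
    simp only [SemidirectProduct.mul_left, SemidirectProduct.mul_right, SemidirectProduct.inv_left,
      Pi.mul_apply, mulAutArrow_apply_perm, Pi.inv_apply, Int.units_inv_eq_self, twist_left, twist_right,
      SemidirectProduct.left_inl, SemidirectProduct.right_inl,
      map_one, one_pow, mul_one, inv_inv]
    rw [perm_apply_inv_apply, mul_right_comm, units_mul_self, one_mul]
  · show c.right * 1 * c.right⁻¹ = 1
    simp

theorem injective_permPart_conjTwist {n : ℕ} (c : SignedPerm n) (a b d : Bool) :
    Function.Injective (permPart (conjTwist c a b d)) := by
  intro σ τ h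
  simp only [permPart_apply, conjTwist_inr] at h
  simpa using h

/-- The conditions at coordinate `0` remove the ambiguity of `c` up to the central sign vector `-1`.
-/
theorem conjTwist_injective {k : ℕ} {c c' : SignedPerm (k + 7)} {a b d a' b' d' : Bool}
    (hc : c.left 0 = 1) (hc' : c'.left 0 = 1) (h : conjTwist c a b d = conjTwist c' a' b' d') :
    c = c' ∧ a = a' ∧ b = b' ∧ d = d' := by
  have hinr : ∀ σ, conjTwist c a b d (SemidirectProduct.inr σ) =
    conjTwist c' a' b' d' (SemidirectProduct.inr σ) := fun σ => by rw [h]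
  have hinl : ∀ ε, conjTwist c a b d (SemidirectProduct.inl ε) =
    conjTwist c' a' b' d' (SemidirectProduct.inl ε) := fun σ => by rw [h]
  simp only [conjTwist_inr] at hinr
  simp only [conjTwist_inl, SemidirectProduct.inl_inj] at hinl
  have hτ : c.right = c'.right := Perm.conj_injective (by omega) fun ρ =>
    congrArg SemidirectProduct.right (hinr ρ)
  have hleft : ∀ ρ : Perm (Fin (k + 7)), Perm.sign ρ ^ a.toNat * c.left (ρ⁻¹ 0) =
      Perm.sign ρ ^ a'.toNat * c'.left (ρ⁻¹ 0) := by
    intro ρ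
    have h1 := congrFun (congrArg SemidirectProduct.left
      (hinr (c.right⁻¹ * ρ * c.right))) 0
    rw [← hτ] at h1
    have h2 : c.right * (c.right⁻¹ * ρ * c.right) * c.right⁻¹ = ρ := by group
    have h3 : Perm.sign (c.right⁻¹ * ρ * c.right) = Perm.sign ρ := by
      rw [Perm.sign_mul, Perm.sign_mul, Perm.sign_inv, mul_comm, ← mul_assoc, units_mul_self,
        one_mul]
    simpa only [h2, h3, hc, hc', one_mul] using h1
  have ha : a = a' := by
    have h1 := hleft (swap 1 2)
    have h12 : (1 : Fin (k + 7)) ≠ 2 := by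
      rw [Ne, Fin.ext_iff]
      simp [Nat.mod_eq_of_lt (show 2 < k + 7 by omega)]
    have h01 : (0 : Fin (k + 7)) ≠ 1 := by simp
    have h02 : (0 : Fin (k + 7)) ≠ 2 := by
      rw [Ne, Fin.ext_iff]
      simp [Nat.mod_eq_of_lt (show 2 < k + 7 by omega)]
    rw [swap_inv, swap_apply_of_ne_of_ne h01 h02, hc, hc', mul_one, mul_one,
      Perm.sign_swap h12] at h1
    exact neg_one_pow_toNat_injective h1
  subst ha
  have hu : c.left = c'.left := by
    funext j
    simpa using mul_left_cancel (hleft (swap 0 j))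
  have hθ : ∀ ε, signHom (k + 7) b d ε = signHom (k + 7) b' d' ε := by
    intro ε
    have := hinl ε
    rw [← hτ] at this
    exact (mulAutArrow c.right).injective this
  have hd : d = d' := by
    have := congrFun (hθ (Pi.mulSingle 0 (-1))) 1
    simp only [signHom_mulSingle, Fin.one_eq_zero_iff] at this
    exact neg_one_pow_toNat_injective (by simpa using this)
  subst hd
  have hb : b = b' := by
    have := congrFun (hθ (Pi.mulSingle 0 (-1))) 0
    simp only [signHom_mulSingle, if_pos] at this
    exact neg_one_pow_toNat_injective (mul_right_cancel this)
  exact ⟨SemidirectProduct.ext hu hτ, rfl, hb, rfl⟩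

/-- A flip at `i` commutes with every transposition fixing `i`, so the permutation part of its
image, conjugated back by `τ`, centralises them all. -/
theorem right_map_inl_eq_one {n : ℕ} (hn : 4 ≤ n) {f : Monoid.End (SignedPerm n)}
    {τ : Perm (Fin n)} (hτ : ∀ σ, permPart f σ = τ * σ * τ⁻¹) (ε : Fin n → ℤˣ) :
    (f (SemidirectProduct.inl ε)).right = 1 := by
  suffices h : SemidirectProduct.rightHom.comp (MonoidHom.comp f SemidirectProduct.inl) = 1 from
    DFunLike.congr_fun h ε
  refine MonoidHom.pi_ext fun i x => ?_
  let e : SignedPerm n := SemidirectProduct.inl (Pi.mulSingle i x)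
  show (f e).right = 1
  suffices h : τ⁻¹ * (f e).right * τ = 1 by
    have h1 : (f e).right = τ * (τ⁻¹ * (f e).right * τ) * τ⁻¹ := by group
    rw [h1, h, mul_one, mul_inv_cancel]
  refine Perm.eq_one_of_commute_swap hn i fun j l hj hl => ?_
  have h1 : e = SemidirectProduct.inr (swap j l) * e * SemidirectProduct.inr (swap j l)⁻¹ := by
    have : (SemidirectProduct.inl (mulAutArrow (swap j l) (Pi.mulSingle i x)) :
      SignedPerm n) = _ := SemidirectProduct.inl_aut _ _
    rwa [mulAutArrow_mulSingle, swap_apply_of_ne_of_ne hj.symm hl.symm] at this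
  have h2 := congrArg (fun y => (f y).right) h1
  simp only [map_mul, map_inv, SemidirectProduct.mul_right, SemidirectProduct.inv_right,
    ← permPart_apply, hτ] at h2
  rw [eq_mul_inv_iff_mul_eq] at h2
  show _ * _ = _ * _
  have h3 := congrArg (fun y => τ⁻¹ * y * τ) h2
  simpa [mul_assoc] using h3

theorem exists_eq_conjTwist {k : ℕ} {f : Monoid.End (SignedPerm (k + 7))}
    (hf : Function.Injective (permPart f)) :
    ∃ (c : SignedPerm (k + 7)) (a b d : Bool), c.left 0 = 1 ∧ f = conjTwist c a b d := by
  obtain ⟨τ, hτ⟩ := Perm.exists_eq_conj_of_injective (by omega) hf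
  have hN : ∀ ε, (f (SemidirectProduct.inl ε)).right = 1 := right_map_inl_eq_one (by omega) hτ
  have hfinv : ∀ ρ : Perm (Fin (k + 7)),
      (f (SemidirectProduct.inr (τ⁻¹ * ρ * τ))).right = ρ := by
    intro ρ
    rw [← permPart_apply, hτ]
    group
  -- Precomposing with conjugation by `τ⁻¹` makes the permutation part the identity, which turns the
  -- sign part into a cocycle; `θ` below is untwisted likewise.
  obtain ⟨a, u, hu0, hu⟩ := cocycle_eq
    (F := fun ρ => (f (SemidirectProduct.inr (τ⁻¹ * ρ * τ))).left) (by
      intro σ ρ i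
      have h1 : τ⁻¹ * (σ * ρ) * τ = (τ⁻¹ * σ * τ) * (τ⁻¹ * ρ * τ) := by group
      rw [h1, map_mul, map_mul, SemidirectProduct.mul_left, Pi.mul_apply, mulAutArrow_apply_perm,
        hfinv])
  let θ : (Fin (k + 7) → ℤˣ) →* (Fin (k + 7) → ℤˣ) :=
    { toFun := fun ε => (f (SemidirectProduct.inl (mulAutArrow τ⁻¹ ε))).left
      map_one' := by simp
      map_mul' := fun ε δ => by
        rw [map_mul, map_mul, map_mul, SemidirectProduct.mul_left, hN, map_one,
          MulAut.one_apply] }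
  have hθ : ∀ (σ : Perm (Fin (k + 7))) ε, θ (mulAutArrow σ ε) = mulAutArrow σ (θ ε) := by
    intro σ ε
    show (f (SemidirectProduct.inl (mulAutArrow τ⁻¹ (mulAutArrow σ ε)))).left = _
    have h1 : (mulAutArrow τ⁻¹ (mulAutArrow σ ε) : Fin (k + 7) → ℤˣ) =
        mulAutArrow (τ⁻¹ * σ * τ) (mulAutArrow τ⁻¹ ε) := by
      rw [← MulAut.mul_apply, ← MulAut.mul_apply, ← map_mul, ← map_mul]
      congr 2
      group
    rw [h1, SemidirectProduct.inl_aut, map_mul, map_mul, SemidirectProduct.mul_left,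
      SemidirectProduct.mul_left, SemidirectProduct.mul_right, hN, hfinv, mul_one,
      map_inv SemidirectProduct.inr, map_inv f,
      SemidirectProduct.inv_left, hfinv]
    funext i
    simp only [Pi.mul_apply, mulAutArrow_apply_perm, inv_inv, perm_apply_inv_apply, Pi.inv_apply]
    rw [mul_right_comm, mul_inv_cancel, one_mul]
    rfl
  obtain ⟨b, d, hbd⟩ := eq_signHom_of_equivariant (by omega) θ hθ
  refine ⟨⟨u, τ⟩, a, b, d, hu0, SemidirectProduct.hom_ext ?_ ?_⟩
  · refine MonoidHom.ext fun ε => ?_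
    show f (SemidirectProduct.inl ε) = conjTwist _ a b d (SemidirectProduct.inl ε)
    rw [conjTwist_inl]
    refine SemidirectProduct.ext ?_ (hN ε)
    show _ = (mulAutArrow τ (signHom (k + 7) b d ε) : Fin (k + 7) → ℤˣ)
    rw [← hbd, ← hθ]
    show _ = (f (SemidirectProduct.inl (mulAutArrow τ⁻¹ (mulAutArrow τ ε)))).left
    rw [← MulAut.mul_apply, ← map_mul, inv_mul_cancel, map_one, MulAut.one_apply]
  · refine MonoidHom.ext fun σ => ?_
    show f (SemidirectProduct.inr σ) = conjTwist _ a b d (SemidirectProduct.inr σ)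
    rw [conjTwist_inr]
    refine SemidirectProduct.ext ?_ (hτ σ)
    funext i
    have h1 := hu (τ * σ * τ⁻¹) i
    have h2 : τ⁻¹ * (τ * σ * τ⁻¹) * τ = σ := by group
    have h3 : Perm.sign (τ * σ * τ⁻¹) = Perm.sign σ := by
      rw [Perm.sign_mul, Perm.sign_mul, Perm.sign_inv, mul_right_comm, units_mul_self,
        one_mul]
    simpa only [h2, h3] using h1

theorem card_injective_permPart (k : ℕ) :
    Nat.card {f : Monoid.End (SignedPerm (k + 7)) // Function.Injective (permPart f)} =
      2 ^ (k + 7 + 2) * (k + 7)! := by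
  let F : ((Fin (k + 6) → ℤˣ) × Perm (Fin (k + 7))) × Bool × Bool × Bool →
      {f : Monoid.End (SignedPerm (k + 7)) // Function.Injective (permPart f)} := fun x =>
    ⟨conjTwist ⟨Fin.cons 1 x.1.1, x.1.2⟩ x.2.1 x.2.2.1 x.2.2.2, injective_permPart_conjTwist _ _ _ _⟩
  have hF : Function.Bijective F := by
    constructor
    · rintro ⟨⟨v, τ⟩, a, b, d⟩ ⟨⟨v', τ'⟩, a', b', d'⟩ h
      obtain ⟨hc, rfl, rfl, rfl⟩ := conjTwist_injective rfl rfl (congrArg Subtype.val h)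
      have hr : τ = τ' := congrArg SemidirectProduct.right hc
      have hl : v = v' := Fin.cons_right_injective (α := fun _ => ℤˣ) 1
        (congrArg SemidirectProduct.left hc)
      rw [hr, hl]
    · rintro ⟨f, hf⟩
      obtain ⟨⟨u, τ⟩, a, b, d, hc, rfl⟩ := exists_eq_conjTwist hf
      refine ⟨((Fin.tail u, τ), a, b, d), Subtype.ext ?_⟩
      have : (Fin.cons 1 (Fin.tail u) : Fin (k + 7) → ℤˣ) = u := by
        rw [← show u 0 = 1 from hc]
        exact Fin.cons_self_tail u
      simp only [F, this]
  rw [← Nat.card_congr (Equiv.ofBijective F hF)]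
  simp only [Nat.card_eq_fintype_card, Fintype.card_prod, Fintype.card_fun, Fintype.card_perm,
    Fintype.card_fin, Fintype.card_bool, Fintype.card_units_int]
  ring

end SignedPerm

/-! ### Asymptotics -/

namespace SignedPerm

theorem numEnd_eq_add (n : ℕ) : numEnd n =
    Nat.card {f : Monoid.End (SignedPerm n) // Function.Injective (permPart f)} +
    Nat.card {f : Monoid.End (SignedPerm n) // ¬ Function.Injective (permPart f)} := by
  classical
  rw [numEnd, ← Nat.card_sum]
  exact Nat.card_congr (Equiv.sumCompl _).symm

theorem card_injective_permPart_of_le {n : ℕ} (hn : 7 ≤ n) :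
    Nat.card {f : Monoid.End (SignedPerm n) // Function.Injective (permPart f)} =
      2 ^ (n + 2) * n ! := by
  obtain ⟨k, rfl⟩ := Nat.exists_eq_add_of_le' hn
  exact card_injective_permPart k

/-- The fourth power removes the rounded exponent `3n/4`. With `n ^ n ≤ e ^ n * n!`, the numerator
gives `(n!)^3` against `(n!)^4` below. -/
theorem pow_four_bound {n : ℕ} (hn : 0 < n) :
    ((2 : ℝ) ^ (9 * n) * (n : ℝ) ^ (3 * n / 4) / (2 ^ (n + 2) * n !)) ^ 4 ≤
      (2 ^ 32 * Real.exp 1 ^ 4) ^ n / n ! := by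
  have hn' : (0 : ℝ) < n := by exact_mod_cast hn
  have hf : (0 : ℝ) < n ! := by exact_mod_cast n.factorial_pos
  have hexp : (n : ℝ) ^ n ≤ Real.exp 1 ^ n * n ! := by
    have := Real.pow_div_factorial_le_exp (n : ℝ) hn'.le n
    rwa [div_le_iff₀ hf, ← Real.exp_one_pow] at this
  have hpow : ((n : ℝ) ^ (3 * n / 4)) ^ 4 ≤ ((n : ℝ) ^ n) ^ 3 := by
    rw [← pow_mul, ← pow_mul]
    exact pow_le_pow_right₀ (by exact_mod_cast hn) (by omega)
  have h3 : ((n : ℝ) ^ n) ^ 3 ≤ (Real.exp 1 ^ n * n !) ^ 3 :=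
    pow_le_pow_left₀ (by positivity) hexp 3
  have hexp1 : (Real.exp 1 ^ n) ^ 3 ≤ (Real.exp 1 ^ n) ^ 4 :=
    pow_le_pow_right₀ (one_le_pow₀ (Real.one_le_exp zero_le_one)) (by norm_num)
  have h2 : ((2 : ℝ) ^ (9 * n)) ^ 4 ≤ (2 ^ 32) ^ n * (2 ^ (n + 2)) ^ 4 := by
    rw [← pow_mul, ← pow_mul, ← pow_mul, ← pow_add]
    exact pow_le_pow_right₀ (by norm_num) (by omega)
  rw [div_pow, div_le_div_iff₀ (by positivity) hf]
  calc ((2 : ℝ) ^ (9 * n) * (n : ℝ) ^ (3 * n / 4)) ^ 4 * n !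
      = ((2 : ℝ) ^ (9 * n)) ^ 4 * ((n : ℝ) ^ (3 * n / 4)) ^ 4 * n ! := by rw [mul_pow]
    _ ≤ ((2 ^ 32) ^ n * (2 ^ (n + 2)) ^ 4) * (Real.exp 1 ^ n * n !) ^ 3 * n ! := by
        gcongr
        exact hpow.trans h3
    _ = ((2 ^ 32) ^ n * (2 ^ (n + 2)) ^ 4) * ((Real.exp 1 ^ n) ^ 3 * (n ! : ℝ) ^ 4) := by ring
    _ ≤ ((2 ^ 32) ^ n * (2 ^ (n + 2)) ^ 4) * ((Real.exp 1 ^ n) ^ 4 * (n ! : ℝ) ^ 4) := by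
        gcongr
    _ = (2 ^ 32 * Real.exp 1 ^ 4) ^ n * (2 ^ (n + 2) * n !) ^ 4 := by
        rw [mul_pow (2 ^ 32 : ℝ), mul_pow _ (n ! : ℝ), ← pow_mul (Real.exp 1) 4, mul_comm 4,
          pow_mul (Real.exp 1) n]
        ring

theorem tendsto_bound : Tendsto (fun n : ℕ =>
    (2 : ℝ) ^ (9 * n) * (n : ℝ) ^ (3 * n / 4) / (2 ^ (n + 2) * n !)) atTop (𝓝 0) := by
  have h4 : Tendsto (fun n : ℕ =>
      ((2 : ℝ) ^ (9 * n) * (n : ℝ) ^ (3 * n / 4) / (2 ^ (n + 2) * n !)) ^ 4) atTop (𝓝 0) :=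
    squeeze_zero' (Eventually.of_forall fun n => by positivity)
      ((eventually_gt_atTop 0).mono fun n hn => pow_four_bound hn)
      (FloorSemiring.tendsto_pow_div_factorial_atTop _)
  have h := h4.rpow_const (p := ((4 : ℕ) : ℝ)⁻¹) (Or.inr (by positivity))
  rw [Real.zero_rpow (by norm_num)] at h
  refine h.congr fun n => ?_
  exact Real.pow_rpow_inv_natCast (by positivity) (by norm_num)

theorem tendsto_numEnd_div : Tendsto (fun n : ℕ =>
    (numEnd n : ℝ) / (2 ^ (n + 2) * n !)) atTop (𝓝 1) := by
  have hlim : Tendsto (fun n : ℕ => 1 + (2 : ℝ) ^ (9 * n) * (n : ℝ) ^ (3 * n / 4) /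
      (2 ^ (n + 2) * n !)) atTop (𝓝 1) := by
    simpa using tendsto_bound.const_add 1
  refine tendsto_of_tendsto_of_tendsto_of_le_of_le' tendsto_const_nhds hlim ?_ ?_
  · filter_upwards [eventually_ge_atTop 7] with n hn
    rw [one_le_div (by positivity), numEnd_eq_add, card_injective_permPart_of_le hn]
    push_cast
    exact le_add_of_nonneg_right (by positivity)
  · filter_upwards [eventually_ge_atTop 7] with n hn
    have hpos : (0 : ℝ) < 2 ^ (n + 2) * n ! := by positivity
    have h1 := (card_not_injective_permPart_le (show 5 ≤ n by omega)).trans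
      (card_commutingInvolutions_signedPerm_le n)
    have h2 : (Nat.card {f : Monoid.End (SignedPerm n) // ¬ Function.Injective (permPart f)} : ℝ) ≤
        2 ^ (9 * n) * (n : ℝ) ^ (3 * n / 4) := by exact_mod_cast h1
    rw [numEnd_eq_add, card_injective_permPart_of_le hn, ← div_self hpos.ne', ← add_div]
    push_cast
    gcongr

theorem imageOrderLaw_apply (n : ℕ) (s : Set ℕ) :
    (imageOrderLaw n).toOuterMeasure s =
      ENNReal.ofReal ((Nat.card (imageOrder n ⁻¹' s) : ℝ) / numEnd n) := by
  classical
  have hpos : (0 : ℝ) < numEnd n := by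
    rw [numEnd]
    exact_mod_cast Nat.card_pos
  rw [imageOrderLaw, PMF.toOuterMeasure_map_apply, PMF.toOuterMeasure_uniformOfFintype_apply,
    ENNReal.ofReal_div_of_pos hpos, ENNReal.ofReal_natCast, ENNReal.ofReal_natCast, numEnd,
    Nat.card_eq_fintype_card, Nat.card_eq_fintype_card]

theorem tendsto_imageOrderLaw : Tendsto (fun n : ℕ =>
    (imageOrderLaw n).toOuterMeasure (Set.Icc (n !) (2 ^ n * n !))) atTop (𝓝 1) := by
  simp only [imageOrderLaw_apply]
  rw [← ENNReal.ofReal_one]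
  refine ENNReal.tendsto_ofReal ?_
  have hlim := tendsto_numEnd_div.inv₀ one_ne_zero
  rw [inv_one] at hlim
  have hpos : ∀ n, (0 : ℝ) < numEnd n := fun n => by
    rw [numEnd]
    exact_mod_cast Nat.card_pos
  -- The probability is at least the proportion of endomorphisms with injective permutation part,
  -- the inverse of the ratio in `tendsto_numEnd_div`.
  refine tendsto_of_tendsto_of_tendsto_of_le_of_le' hlim tendsto_const_nhds ?_ ?_
  · filter_upwards [eventually_ge_atTop 7] with n hn
    rw [inv_div]
    refine div_le_div_of_nonneg_right ?_ (hpos n).le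
    have h1 := card_injective_permPart_of_le hn
    have h2 : Nat.card {f : Monoid.End (SignedPerm n) // Function.Injective (permPart f)} ≤
        Nat.card (imageOrder n ⁻¹' Set.Icc (n !) (2 ^ n * n !)) :=
      Nat.card_le_card_of_injective
        (fun f => ⟨f.1, factorial_le_imageOrder f.2, imageOrder_le n f.1⟩) fun f g h =>
          Subtype.ext (congrArg (fun x => x.1) h)
    rw [h1] at h2
    exact_mod_cast h2
  · refine Eventually.of_forall fun n => ?_
    rw [div_le_one (hpos n), numEnd]
    exact_mod_cast Nat.card_le_card_of_injective _ Subtype.val_injective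

end SignedPerm

theorem mainTheorem6 :
    (∀ n : ℕ, Nat.card (SignedPerm n) = 2 ^ n * n !) ∧
    Tendsto (fun n : ℕ => (imageOrderLaw n).toOuterMeasure (Set.Icc (n !) (2 ^ n * n !)))
      atTop (𝓝 1) ∧
    (fun n : ℕ => (numEnd n : ℝ)) ~[atTop] (fun n : ℕ => (2 : ℝ) ^ (n + 2) * (n ! : ℝ)) := by
  refine ⟨SignedPerm.card_eq, SignedPerm.tendsto_imageOrderLaw, ?_⟩
  rw [isEquivalent_iff_tendsto_one (Eventually.of_forall fun n => by positivity)]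
  exact SignedPerm.tendsto_numEnd_div
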